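/- Let $X_b>0$, $\epsilon>0$, and let $x_1,\dots,x_n\in\mathbb{R}^p$ with $\|x_i\|_2\le X_b$. Let $A_1,A_2$ be real $p\times p$ matrices, $c_{j\nu}\in\mathbb{R}$ and $\delta_\nu>0$ ($1\le j\le p$, $1\le \nu\le V$), and let $$\mathcal F=\Big\{f:\ f(x)=\beta^Tx,\ \beta\in\mathbb{R}^p,\ \beta^TA_1\beta\le 1,\ \beta^TA_2\beta\le 1,\ \sum_{j=1}^p c_{j\nu}\beta_j+\delta_\nu\le 1\ \text{ for } \nu=1,\dots,V\Big\}$$ and $\mathcal F_{|S}=\{(f(x_1),\dots,f(x_n)): f\in\mathcal F\}\subset\mathbb{R}^n$. Let $A_{\mathrm{int}\gamma}$ be any symmetric positive definite matrix whose ellipsoid circumscribes the quadratic constraints, that is, $\{\beta:\beta^TA_1\beta\le1,\ \beta^TA_2\beta\le1\}\subseteq\{\beta:\beta^TA_{\mathrm{int}\gamma}\beta\le 1\}$, and put $B=\sqrt{\lambda_{\max}(A_{\mathrm{int}\gamma}^{-1})}$. Let $N(r,\mathcal F_{|S},\|\cdot\|_2)$ be the least size of a finite set $U\subset\mathbb{R}^n$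 such that every point of $\mathcal F_{|S}$ is at Euclidean distance at most $r$ from $U$. Let $X_L=[x_1\cdots x_n]\in\mathbb{R}^{p\times n}$ with rows $h_1,\dots,h_p\in\mathbb{R}^n$, let $\tilde c_{j\nu}=c_{j\nu}\sqrt n\,X_bB/\|h_j\|_2$, and let $X_{sL}$ be the diagonal matrix with entries $\sqrt n\,X_bB/\|h_j\|_2$ times $X_L$. For $K\in\mathbb{N}$ let $P^K=\{k\in\mathbb{Z}^p:\sum_j|k_j|\le K\}$ and $P_c^K=\{k\in P^K:\sum_j\tilde c_{j\nu}k_j\le K\ \text{ for all }\nu\}$. Let $$K_0=\Big\lceil\frac{X_b^2\lambda_{\max}(A_{\mathrm{int}\gamma}^{-1})}{\epsilon^2}\Big\rceil,\qquad K=\max\Bigg\{K_0,\Bigg\lceil\frac{nX_b^2\lambda_{\max}(A_{\mathrm{int}\gamma}^{-1})}{\lambda_{\min}(X_{sL}X_{sL}^T)\big[\min_{\nu}\frac{\delta_\nu}{\sum_j|\tilde c_{j\nu}|}\big]^2}\Bigg\rceil\Bigg\},$$ where $\delta_\nu/0=\infty$, the minimum over no $\nu$ is $\infty$, and dividing by $\infty$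 gives $0$. Then $$N(\sqrt n\,\epsilon,\mathcal F_{|S},\|\cdot\|_2)\le\begin{cases}\min\{|P^{K_0}|,|P_c^K|\}&\text{if }\epsilon<X_b\sqrt{\lambda_{\max}(A_{\mathrm{int}\gamma}^{-1})},\\ 1&\text{otherwise.}\end{cases}$$ Here $P_c^K$ is defined when all $h_j$ are nonzero and $\lambda_{\min}(X_{sL}X_{sL}^T)>0$ (that is, when $X_L$ has linearly independent rows); if this fails, the first case is to be read with $|P^{K_0}|$ alone (that is, $K=\infty$). -/

import Mathlib

open scoped NNReal ENNReal Matrix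

noncomputable section

/-- The smallest eigenvalue of a real square matrix (used for symmetric matrices only). -/
def lambdaMin {p : ℕ} (A : Matrix (Fin p) (Fin p) ℝ) : ℝ := sInf (spectrum ℝ A)

/-- The largest eigenvalue of a real square matrix (used for symmetric matrices only). -/
def lambdaMax {p : ℕ} (A : Matrix (Fin p) (Fin p) ℝ) : ℝ := sSup (spectrum ℝ A)

/-- The sublevel set `{β ∈ ℝ^p : βᵀ A β ≤ 1}`; an ellipsoid when `A` is positive definite. -/
def ellipsoid {p : ℕ} (A : Matrix (Fin p) (Fin p) ℝ) : Set (EuclideanSpace ℝ (Fin p)) :=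
  {β | β.ofLp ⬝ᵥ (A *ᵥ β.ofLp) ≤ 1}

/-- The linear functions `f(x) = βᵀ x` whose coefficient vector satisfies the two quadratic
constraints `βᵀ A₁ β ≤ 1`, `βᵀ A₂ β ≤ 1` and the `V` linear constraints
`∑ j, c j ν * β j + δ ν ≤ 1`. -/
def functionClass {p V : ℕ} (A₁ A₂ : Matrix (Fin p) (Fin p) ℝ)
    (c : Fin p → Fin V → ℝ) (δ : Fin V → ℝ) : Set (EuclideanSpace ℝ (Fin p) → ℝ) :=
  {f | ∃ β : EuclideanSpace ℝ (Fin p), (∀ x, f x = ∑ j, β j * x j) ∧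
    β ∈ ellipsoid A₁ ∧ β ∈ ellipsoid A₂ ∧ ∀ ν, ∑ j, c j ν * β j + δ ν ≤ 1}

/-- `F|S = {(f(x₁), …, f(xₙ)) : f ∈ F}`, a subset of `ℝⁿ` with the Euclidean norm. -/
def restrictTo {p n : ℕ} (F : Set (EuclideanSpace ℝ (Fin p) → ℝ))
    (x : Fin n → EuclideanSpace ℝ (Fin p)) : Set (EuclideanSpace ℝ (Fin n)) :=
  {v | ∃ f ∈ F, v = WithLp.toLp 2 fun i => f (x i)}

/-- The covering number `N(r, A, ‖·‖₂)`: the least size of a set `U` of points of the ambient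
space, not necessarily in `A`, such that each point of `A` is at distance at most `r` from `U`
(`⊤` if there is no finite such set). Used with `r ≥ 0` only. -/
def coveringNumber {n : ℕ} (r : ℝ) (A : Set (EuclideanSpace ℝ (Fin n))) : ℕ∞ :=
  Metric.externalCoveringNumber r.toNNReal A

/-- The `p × n` feature matrix `X_L = [x₁ ⋯ xₙ]`. -/
def featureMatrix {p n : ℕ} (x : Fin n → EuclideanSpace ℝ (Fin p)) :
    Matrix (Fin p) (Fin n) ℝ :=
  Matrix.of fun j i => x i j

/-- The vector `h_j ∈ ℝⁿ` of the values of the `j`-th feature, that is, the `j`-th row of `X_L`. -/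
def featureVector {p n : ℕ} (x : Fin n → EuclideanSpace ℝ (Fin p)) (j : Fin p) :
    EuclideanSpace ℝ (Fin n) :=
  WithLp.toLp 2 fun i => x i j

/-- The scaling factor `√n * X_b * B / ‖h_j‖₂`. -/
def featureScale {p n : ℕ} (x : Fin n → EuclideanSpace ℝ (Fin p)) (Xb B : ℝ) (j : Fin p) : ℝ :=
  √(n : ℝ) * Xb * B / ‖featureVector x j‖

/-- The scaled coefficients `c̃ j ν = c j ν * √n * X_b * B / ‖h_j‖₂`. -/
def scaledCoeff {p n V : ℕ} (x : Fin n → EuclideanSpace ℝ (Fin p)) (Xb B : ℝ)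
    (c : Fin p → Fin V → ℝ) : Fin p → Fin V → ℝ :=
  fun j ν => c j ν * featureScale x Xb B j

/-- The scaled feature matrix `X_sL`: the diagonal matrix of the scaling factors times `X_L`. -/
def scaledFeatureMatrix {p n : ℕ} (x : Fin n → EuclideanSpace ℝ (Fin p)) (Xb B : ℝ) :
    Matrix (Fin p) (Fin n) ℝ :=
  Matrix.diagonal (featureScale x Xb B) * featureMatrix x

/-- `λ_min(X_sL X_sLᵀ)`. It is positive exactly when `X_L` has linearly independent rows
(if `p, n, X_b, B > 0`); in particular all `h_j` are then nonzero. -/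
def scaledGramMin {p n : ℕ} (x : Fin n → EuclideanSpace ℝ (Fin p)) (Xb B : ℝ) : ℝ :=
  lambdaMin (scaledFeatureMatrix x Xb B * (scaledFeatureMatrix x Xb B)ᵀ)

/-- The set `P^K` of integer points `k` with `∑ j, |k j| ≤ K`. -/
def intPolytope (p K : ℕ) : Set (Fin p → ℤ) :=
  {k | ∑ j, |k j| ≤ (K : ℤ)}

/-- The set `P_c^K` of points `k` of `P^K` with `∑ j, c̃ j ν * k j ≤ K` for all `ν`. -/
def constrainedIntPolytope {p V : ℕ} (ct : Fin p → Fin V → ℝ) (K : ℕ) : Set (Fin p → ℤ) :=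
  {k | k ∈ intPolytope p K ∧ ∀ ν, ∑ j, ct j ν * (k j : ℝ) ≤ (K : ℝ)}

/-- `K₀ = ⌈X_b² B² / ε²⌉`. -/
def K₀ (Xb B ε : ℝ) : ℕ := ⌈Xb ^ 2 * B ^ 2 / ε ^ 2⌉₊

/-- `min_ν δ_ν / ∑ j, |c̃ j ν|`. It is taken in `[0, ∞]`, so that a quotient `δ_ν / 0` (with
`δ_ν > 0`) and the minimum over no constraint at all are `∞`. -/
def margin {p V : ℕ} (ct : Fin p → Fin V → ℝ) (δ : Fin V → ℝ) : ℝ≥0∞ :=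
  ⨅ ν, ENNReal.ofReal (δ ν) / ENNReal.ofReal (∑ j, |ct j ν|)

/-- `K = max {K₀, ⌈n X_b² B² / (λ_min(X_sL X_sLᵀ) * (min_ν δ_ν / ∑ j, |c̃ j ν|)²)⌉}`, where the
second term is `0` if the minimum is `∞`. It is meant, and used, for `λ_min(X_sL X_sLᵀ) > 0` and
`δ > 0`, where the quotient is finite. -/
def constrainedK {p n V : ℕ} (x : Fin n → EuclideanSpace ℝ (Fin p)) (Xb B ε : ℝ)
    (c : Fin p → Fin V → ℝ) (δ : Fin V → ℝ) : ℕ :=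
  max (K₀ Xb B ε)
    ⌈(ENNReal.ofReal (n * Xb ^ 2 * B ^ 2) /
      (ENNReal.ofReal (scaledGramMin x Xb B) *
        margin (scaledCoeff x Xb B c) δ ^ 2)).toReal⌉₊

end

/-!
A point of `F|S` is `v = ∑ j, β j • h j`, where `h j` is the `j`-th feature vector and `‖β‖ ≤ B`
(`norm_sq_le_lambdaMax_inv`). By Cauchy–Schwarz, `∑ j, |β j| * ‖h j‖ ≤ √n * Xb * B =: b`. For
`ε ≥ Xb * B` this puts all of `F|S` into the ball of radius `√n * ε` about `0`. For smaller `ε` it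
says that `v = ∑ j, t j • g j` with `∑ j, |t j| ≤ 1`, where `g j` is the multiple of `h j` of norm
`b` (and `0` if `h j = 0`). Maurey's empirical method, in the form of a greedy induction
(`exists_int_combination`), gives for each `K ≥ 1` an integer point `k` with `∑ j, |k j| ≤ K` such
that `∑ j, (k j / K) • g j` is within `b / √K` of `v`; this is at most `√n * ε` once
`K ≥ K₀`, so `P^K` indexes a cover.

If the scaled Gram matrix is nonsingular, with smallest eigenvalue `μ > 0`, then an error of
`b / √K` in `v` means an error of at most `b / √(μ * K)` in the coefficients
(`scaledGramMin_mul_sum_sq_le`). For the `K` of the theorem this is at most the margin, so `k / K`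
inherits the linear constraints from `t`, which satisfies them with slack `δ`
(`mem_constrainedIntPolytope`). Hence the centres indexed by `P_c^K` suffice.
-/

/-! ### Approximation by integer combinations -/

/-- The greedy step of Maurey's method. The candidates for the correction `∑ j, m j • g j` are
`sign (t j) • g j`, with weight `|t j|`, and `0`, with the remaining weight; their weighted mean is
`v = ∑ j, t j • g j`, so the weighted mean of the squared residuals is at most `‖r‖² + b²`, and
some candidate does no worse than the mean. -/
theorem exists_signed_step {ι E : Type*} [Fintype ι] [NormedAddCommGroup E]
    [InnerProductSpace ℝ E] (g : ι → E) (t : ι → ℝ) (b : ℝ) (hg : ∀ j, ‖g j‖ ≤ b)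
    (ht : ∑ j, |t j| ≤ 1) (r : E) :
    ∃ m : ι → ℤ, ∑ j, |m j| ≤ 1 ∧
      ‖r + ∑ j, t j • g j - ∑ j, (m j : ℝ) • g j‖ ^ 2 ≤ ‖r‖ ^ 2 + b ^ 2 := by
  classical
  set v := ∑ j, t j • g j with hv
  let w : Option ι → ℝ := fun a => a.elim (1 - ∑ j, |t j|) fun j => |t j|
  let s : Option ι → E := fun a => a.elim 0 fun j => (SignType.sign (t j) : ℝ) • g j
  have hw₁ : ∑ a, w a = 1 := by simp [Fintype.sum_option, w]
  have hw₀ : ∀ a, 0 ≤ w a := by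
    rintro (_ | j)
    · simpa [w] using ht
    · simp [w]
  have hsign : ∀ j, |t j| * (SignType.sign (t j) : ℝ) = t j := fun j => by
    rw [mul_comm]; exact sign_mul_abs (t j)
  have hmean : ∑ a, w a • s a = v := by
    simp [Fintype.sum_option, w, s, smul_smul, hsign, hv]
  have hs : ∀ a, w a * ‖s a‖ ^ 2 ≤ w a * b ^ 2 := by
    intro a
    refine mul_le_mul_of_nonneg_left ?_ (hw₀ a)
    rcases a with _ | j
    · simpa [s] using sq_nonneg b
    · have h1 : |(SignType.sign (t j) : ℝ)| ≤ 1 := by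
        rcases lt_trichotomy (t j) 0 with h | h | h <;> simp [h]
      have : ‖s (some j)‖ ≤ b := by
        simp only [s, Option.elim, norm_smul, Real.norm_eq_abs]
        nlinarith [hg j, norm_nonneg (g j), abs_nonneg (SignType.sign (t j) : ℝ)]
      gcongr
  have hexp : ∑ a, w a * ‖r + v - s a‖ ^ 2 ≤ ‖r‖ ^ 2 + b ^ 2 := by
    have h1 : ∑ a, w a * ‖r + v - s a‖ ^ 2
        = ‖r + v‖ ^ 2 - 2 * inner ℝ (r + v) v + ∑ a, w a * ‖s a‖ ^ 2 := by
      calc ∑ a, w a * ‖r + v - s a‖ ^ 2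
          = ∑ a, (w a * ‖r + v‖ ^ 2 - 2 * inner ℝ (r + v) (w a • s a) + w a * ‖s a‖ ^ 2) := by
            refine Finset.sum_congr rfl fun a _ => ?_
            rw [norm_sub_sq_real, inner_smul_right]; ring
        _ = _ := by
            rw [Finset.sum_add_distrib, Finset.sum_sub_distrib, ← Finset.sum_mul, hw₁,
              ← Finset.mul_sum, ← inner_sum, hmean, one_mul]
    have h2 : ∑ a, w a * ‖s a‖ ^ 2 ≤ b ^ 2 := by
      refine (Finset.sum_le_sum fun a _ => hs a).trans ?_
      rw [← Finset.sum_mul, hw₁, one_mul]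
    -- The mean of the squared residuals is `‖r‖² - ‖v‖² + ∑ a, w a * ‖s a‖²`.
    have h3 := norm_sub_sq_real (r + v) v
    rw [add_sub_cancel_right] at h3
    nlinarith [sq_nonneg ‖v‖]
  obtain ⟨a, -, ha⟩ := (concaveOn_id (𝕜 := ℝ) convex_univ).exists_le_of_centerMass
    (t := Finset.univ) (w := w) (p := fun a => ‖r + v - s a‖ ^ 2) (fun a _ => hw₀ a)
    (by rw [hw₁]; exact one_pos) (fun _ _ => Set.mem_univ _)
  rw [Finset.centerMass_eq_of_sum_1 _ _ hw₁] at ha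
  have ha' := ha.trans hexp
  rcases a with _ | j
  · exact ⟨0, by simp, by simpa [s] using ha'⟩
  · refine ⟨Pi.single j (SignType.sign (t j) : ℤ), ?_, ?_⟩
    · rw [Finset.sum_eq_single j (fun i _ hi => by simp [hi]) (by simp)]
      rcases lt_trichotomy (t j) 0 with h | h | h <;> simp [h]
    · rw [Finset.sum_eq_single j (fun i _ hi => by simp [hi]) (by simp)]
      simpa [s] using ha'

/-- Maurey's empirical method: a point of the symmetric convex hull of the `g j` is within
`b / √K` of a combination of the `g j` with coefficients `k j / K`, where `∑ j, |k j| ≤ K`.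
Multiplied by `K`, the statement makes sense for `K = 0` and follows by induction. -/
theorem exists_int_combination {ι E : Type*} [Fintype ι] [NormedAddCommGroup E]
    [InnerProductSpace ℝ E] (g : ι → E) (t : ι → ℝ) (b : ℝ) (hg : ∀ j, ‖g j‖ ≤ b)
    (ht : ∑ j, |t j| ≤ 1) (K : ℕ) :
    ∃ k : ι → ℤ, ∑ j, |k j| ≤ (K : ℤ) ∧
      ‖(K : ℝ) • ∑ j, t j • g j - ∑ j, (k j : ℝ) • g j‖ ^ 2 ≤ K * b ^ 2 := by
  induction K with
  | zero => exact ⟨0, by simp, by simp⟩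
  | succ K ih =>
    obtain ⟨k, hk, hkr⟩ := ih
    obtain ⟨m, hm, hmr⟩ := exists_signed_step g t b hg ht
      ((K : ℝ) • ∑ j, t j • g j - ∑ j, (k j : ℝ) • g j)
    refine ⟨k + m, ?_, ?_⟩
    · push_cast
      calc ∑ j, |(k + m) j| ≤ ∑ j, (|k j| + |m j|) :=
            Finset.sum_le_sum fun j _ => abs_add_le _ _
        _ ≤ K + 1 := by rw [Finset.sum_add_distrib]; exact add_le_add hk hm
    · have : ((K + 1 : ℕ) : ℝ) • ∑ j, t j • g j - ∑ j, (((k + m) j : ℤ) : ℝ) • g j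
          = (K : ℝ) • ∑ j, t j • g j - ∑ j, (k j : ℝ) • g j + ∑ j, t j • g j
            - ∑ j, (m j : ℝ) • g j := by
        simp only [Pi.add_apply, Int.cast_add, add_smul, Finset.sum_add_distrib, Nat.cast_add,
          Nat.cast_one, one_smul]
        abel
      rw [this]
      push_cast
      linarith

/-! ### Spectral bounds on quadratic forms -/

/-- The Rayleigh quotient of a symmetric matrix is bounded below by any lower bound of its
spectrum. -/
theorem mul_dotProduct_le_of_le_spectrum {p : ℕ} {A : Matrix (Fin p) (Fin p) ℝ}
    (hA : A.IsHermitian) {m : ℝ} (hm : ∀ μ ∈ spectrum ℝ A, m ≤ μ) (w : Fin p → ℝ) :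
    m * (w ⬝ᵥ w) ≤ w ⬝ᵥ (A *ᵥ w) := by
  have hpsd : (A - algebraMap ℝ _ m).PosSemidef := by
    rw [Matrix.posSemidef_iff_isHermitian_and_spectrum_nonneg]
    refine ⟨?_, ?_⟩
    · exact hA.sub (by simp [Matrix.IsHermitian, Algebra.algebraMap_eq_smul_one])
    · rw [← spectrum.sub_singleton_eq]
      rintro _ ⟨μ, hμ, _, rfl, rfl⟩
      simpa using hm μ hμ
  have := hpsd.dotProduct_mulVec_nonneg w
  simpa [Matrix.sub_mulVec, Algebra.algebraMap_eq_smul_one, Matrix.smul_mulVec] using this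

/-- The ellipsoid of `A` lies in the centred ball whose radius is its longest semi-axis. -/
theorem norm_sq_le_lambdaMax_inv {p : ℕ} {A : Matrix (Fin p) (Fin p) ℝ} (hA : A.PosDef)
    {β : EuclideanSpace ℝ (Fin p)} (hβ : β ∈ ellipsoid A) : ‖β‖ ^ 2 ≤ lambdaMax A⁻¹ := by
  rcases isEmpty_or_nonempty (Fin p) with hp | ⟨⟨i⟩⟩
  -- In dimension `0` the spectrum is empty and `lambdaMax` takes the junk value `sSup ∅ = 0`.
  · simp [Subsingleton.elim β 0, lambdaMax, spectrum.of_subsingleton]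
  have hle : ∀ μ ∈ spectrum ℝ A, 0 < μ ∧ μ⁻¹ ≤ lambdaMax A⁻¹ := by
    intro μ hμ
    refine ⟨?_, ?_⟩
    · rw [hA.1.spectrum_real_eq_range_eigenvalues] at hμ
      obtain ⟨i, rfl⟩ := hμ
      exact hA.eigenvalues_pos i
    · refine le_csSup (Matrix.finite_spectrum A⁻¹).bddAbove ?_
      rw [← hA.isUnit.unit_spec, ← Matrix.coe_units_inv, spectrum.inv₀_mem_inv_iff]
      exact hμ
  obtain ⟨hi, hiM⟩ := hle _ (hA.1.eigenvalues_mem_spectrum_real i)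
  have hM : 0 < lambdaMax A⁻¹ := (inv_pos.2 hi).trans_le hiM
  have h := mul_dotProduct_le_of_le_spectrum hA.1
    (fun μ hμ => inv_le_of_inv_le₀ (hle μ hμ).1 (hle μ hμ).2) β.ofLp
  have hβ' : β.ofLp ⬝ᵥ (A *ᵥ β.ofLp) ≤ 1 := hβ
  have hn : β.ofLp ⬝ᵥ β.ofLp = ‖β‖ ^ 2 := by
    rw [EuclideanSpace.real_norm_sq_eq]; simp [dotProduct, sq]
  rw [hn] at h
  have := h.trans hβ'
  rwa [inv_mul_le_iff₀ hM, mul_one] at this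

/-! ### Covering numbers -/

/-- A covering by a family of centres `u` indexed by `T` bounds the covering number by the size
of `T`; `u` need not be injective. -/
theorem coveringNumber_le_encard {α : Type*} {n : ℕ} {r : ℝ} (hr : 0 ≤ r)
    {A : Set (EuclideanSpace ℝ (Fin n))} (T : Set α) (u : α → EuclideanSpace ℝ (Fin n))
    (h : ∀ v ∈ A, ∃ a ∈ T, ‖v - u a‖ ≤ r) : coveringNumber r A ≤ T.encard := by
  have hc : Metric.IsCover r.toNNReal A (u '' T) := by
    rw [Metric.isCover_iff_subset_iUnion_closedBall]
    intro v hv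
    obtain ⟨a, ha, hva⟩ := h v hv
    simp only [Set.mem_iUnion]
    exact ⟨u a, Set.mem_image_of_mem u ha, by
      rwa [Metric.mem_closedBall, Real.coe_toNNReal r hr, dist_eq_norm]⟩
  exact hc.externalCoveringNumber_le_encard.trans (Set.encard_image_le u T)

/-! ### Feature vectors and scaled coordinates -/

theorem sum_norm_featureVector_sq_le {p n : ℕ} {Xb : ℝ} {x : Fin n → EuclideanSpace ℝ (Fin p)}
    (hx : ∀ i, ‖x i‖ ≤ Xb) : ∑ j, ‖featureVector x j‖ ^ 2 ≤ n * Xb ^ 2 := by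
  have : ∑ j, ‖featureVector x j‖ ^ 2 = ∑ i, ‖x i‖ ^ 2 := by
    simp_rw [EuclideanSpace.real_norm_sq_eq]
    exact Finset.sum_comm
  rw [this]
  calc ∑ i, ‖x i‖ ^ 2 ≤ ∑ _i : Fin n, Xb ^ 2 := by gcongr with i; exact hx i
    _ = n * Xb ^ 2 := by simp

theorem sum_abs_mul_norm_featureVector_le {p n : ℕ} {Xb B : ℝ} (hXb : 0 ≤ Xb)
    {x : Fin n → EuclideanSpace ℝ (Fin p)} (hx : ∀ i, ‖x i‖ ≤ Xb)
    {β : EuclideanSpace ℝ (Fin p)} (hβ : ‖β‖ ≤ B) :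
    ∑ j, |β j| * ‖featureVector x j‖ ≤ √n * Xb * B := by
  calc ∑ j, |β j| * ‖featureVector x j‖
      ≤ √(∑ j, |β j| ^ 2) * √(∑ j, ‖featureVector x j‖ ^ 2) :=
        Real.sum_mul_le_sqrt_mul_sqrt _ _ _
    _ ≤ B * (√n * Xb) := by
        have h1 : √(∑ j, |β j| ^ 2) = ‖β‖ := by
          simp [EuclideanSpace.norm_eq]
        have h2 : √(∑ j, ‖featureVector x j‖ ^ 2) ≤ √n * Xb := by
          refine (Real.sqrt_le_sqrt (sum_norm_featureVector_sq_le hx)).trans_eq ?_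
          rw [Real.sqrt_mul (Nat.cast_nonneg n), Real.sqrt_sq hXb]
        rw [h1]
        exact mul_le_mul hβ h2 (Real.sqrt_nonneg _) ((norm_nonneg _).trans hβ)
    _ = _ := by ring

theorem exists_of_mem_restrictTo_functionClass {p n V : ℕ} {A₁ A₂ : Matrix (Fin p) (Fin p) ℝ}
    {c : Fin p → Fin V → ℝ} {δ : Fin V → ℝ} {x : Fin n → EuclideanSpace ℝ (Fin p)}
    {v : EuclideanSpace ℝ (Fin n)} (hv : v ∈ restrictTo (functionClass A₁ A₂ c δ) x) :
    ∃ β : EuclideanSpace ℝ (Fin p), β ∈ ellipsoid A₁ ∩ ellipsoid A₂ ∧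
      (∀ ν, ∑ j, c j ν * β j + δ ν ≤ 1) ∧ v = ∑ j, β j • featureVector x j := by
  obtain ⟨f, ⟨β, hf, h1, h2, h3⟩, rfl⟩ := hv
  refine ⟨β, ⟨h1, h2⟩, h3, ?_⟩
  ext i
  simp [hf, featureVector]

/-- The coordinates of `∑ j, β j • featureVector x j` with respect to the scaled feature vectors
`featureScale x Xb B j • featureVector x j`. They are `0` where the feature vector is `0`, which
keeps the expansion valid there. -/
noncomputable def scaledCoord {p n : ℕ} (x : Fin n → EuclideanSpace ℝ (Fin p)) (Xb B : ℝ)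
    (β : EuclideanSpace ℝ (Fin p)) (j : Fin p) : ℝ :=
  β j * ‖featureVector x j‖ / (√(n : ℝ) * Xb * B)

theorem sum_abs_scaledCoord_le {p n : ℕ} {Xb B : ℝ} (hXb : 0 < Xb) (hB : 0 < B)
    {x : Fin n → EuclideanSpace ℝ (Fin p)} (hx : ∀ i, ‖x i‖ ≤ Xb)
    {β : EuclideanSpace ℝ (Fin p)} (hβ : ‖β‖ ≤ B) :
    ∑ j, |scaledCoord x Xb B β j| ≤ 1 := by
  have hb : 0 ≤ √(n : ℝ) * Xb * B := by positivity
  simp only [scaledCoord, abs_div, abs_mul _ ‖_‖, abs_norm, abs_of_nonneg hb]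
  rw [← Finset.sum_div]
  exact div_le_one_of_le₀ (sum_abs_mul_norm_featureVector_le hXb.le hx hβ) hb

theorem norm_featureScale_smul_le {p n : ℕ} {Xb B : ℝ} (hXb : 0 < Xb) (hB : 0 < B)
    (x : Fin n → EuclideanSpace ℝ (Fin p)) (j : Fin p) :
    ‖featureScale x Xb B j • featureVector x j‖ ≤ √(n : ℝ) * Xb * B := by
  have hb : 0 ≤ √(n : ℝ) * Xb * B := by positivity
  rw [norm_smul, featureScale, Real.norm_of_nonneg (by positivity)]
  rcases (norm_nonneg (featureVector x j)).eq_or_lt with h | h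
  · simpa [← h] using hb
  · rw [div_mul_cancel₀ _ h.ne']

theorem scaledCoord_mul_featureScale {p n : ℕ} {Xb B : ℝ} (hXb : 0 < Xb) (hB : 0 < B)
    {x : Fin n → EuclideanSpace ℝ (Fin p)} (β : EuclideanSpace ℝ (Fin p)) {j : Fin p}
    (hj : featureVector x j ≠ 0) : scaledCoord x Xb B β j * featureScale x Xb B j = β j := by
  have hn : (0 : ℝ) < n := by
    rcases n with _ | n
    · exact absurd (Subsingleton.elim _ _) hj
    · positivity
  have : 0 < ‖featureVector x j‖ := norm_pos_iff.2 hj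
  unfold scaledCoord featureScale
  field_simp

theorem scaledCoord_smul_featureScale_smul {p n : ℕ} {Xb B : ℝ} (hXb : 0 < Xb) (hB : 0 < B)
    (x : Fin n → EuclideanSpace ℝ (Fin p)) (β : EuclideanSpace ℝ (Fin p)) (j : Fin p) :
    scaledCoord x Xb B β j • featureScale x Xb B j • featureVector x j
      = β j • featureVector x j := by
  by_cases hj : featureVector x j = 0
  · simp [hj]
  · rw [smul_smul, scaledCoord_mul_featureScale hXb hB β hj]

/-- From `K₀` on, Maurey's error `√n * Xb * B / √K` is at most `√n * ε`. -/
theorem norm_sub_inv_smul_le {n K : ℕ} {Xb B ε : ℝ} (hε : 0 < ε) (hK : 0 < K)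
    (hKε : K₀ Xb B ε ≤ K) {v u : EuclideanSpace ℝ (Fin n)}
    (h : ‖(K : ℝ) • v - u‖ ^ 2 ≤ K * (√(n : ℝ) * Xb * B) ^ 2) :
    ‖v - (K : ℝ)⁻¹ • u‖ ≤ √(n : ℝ) * ε := by
  have hK' : (0 : ℝ) < K := Nat.cast_pos.2 hK
  have hle : Xb ^ 2 * B ^ 2 ≤ K * ε ^ 2 := by
    rw [← div_le_iff₀ (by positivity)]
    exact Nat.ceil_le.1 hKε
  have hsmul : (K : ℝ) • v - u = (K : ℝ) • (v - (K : ℝ)⁻¹ • u) := by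
    rw [smul_sub, smul_inv_smul₀ hK'.ne']
  rw [hsmul, norm_smul, Real.norm_of_nonneg hK'.le] at h
  refine le_of_sq_le_sq ?_ (by positivity)
  have hn : √(n : ℝ) ^ 2 = n := Real.sq_sqrt (Nat.cast_nonneg n)
  simp only [mul_pow, hn] at h ⊢
  have h1 : (K : ℝ) ^ 2 * ‖v - (K : ℝ)⁻¹ • u‖ ^ 2 ≤ K ^ 2 * (n * ε ^ 2) := by
    refine h.trans ?_
    have := mul_le_mul_of_nonneg_left hle (mul_nonneg hK'.le (Nat.cast_nonneg n : (0 : ℝ) ≤ n))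
    linarith
  exact le_of_mul_le_mul_left h1 (by positivity)

theorem exists_intPolytope_approx {p n : ℕ} {Xb B : ℝ} (hXb : 0 < Xb) (hB : 0 < B)
    {x : Fin n → EuclideanSpace ℝ (Fin p)} (hx : ∀ i, ‖x i‖ ≤ Xb)
    {β : EuclideanSpace ℝ (Fin p)} (hβ : ‖β‖ ≤ B) (K : ℕ) :
    ∃ k ∈ intPolytope p K,
      ‖(K : ℝ) • ∑ j, β j • featureVector x j
        - ∑ j, (k j : ℝ) • featureScale x Xb B j • featureVector x j‖ ^ 2
        ≤ K * (√(n : ℝ) * Xb * B) ^ 2 := by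
  obtain ⟨k, hk, h⟩ := exists_int_combination
    (fun j => featureScale x Xb B j • featureVector x j) (scaledCoord x Xb B β) _
    (norm_featureScale_smul_le hXb hB x) (sum_abs_scaledCoord_le hXb hB hx hβ) K
  simp only [scaledCoord_smul_featureScale_smul hXb hB] at h
  exact ⟨k, hk, h⟩

/-! ### The margin of the linear constraints -/

theorem margin_pos {p V : ℕ} (ct : Fin p → Fin V → ℝ) {δ : Fin V → ℝ} (hδ : ∀ ν, 0 < δ ν) :
    0 < margin ct δ := by
  rcases isEmpty_or_nonempty (Fin V) with hV | hV
  · rw [margin, iInf_of_empty]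
    exact ENNReal.zero_lt_top
  obtain ⟨ν, hν⟩ := exists_eq_ciInf_of_finite
    (f := fun ν => ENNReal.ofReal (δ ν) / ENNReal.ofReal (∑ j, |ct j ν|))
  rw [margin, ← hν]
  exact ENNReal.div_pos (ENNReal.ofReal_pos.2 (hδ ν)).ne' ENNReal.ofReal_ne_top

theorem margin_le {p V : ℕ} (ct : Fin p → Fin V → ℝ) {δ : Fin V → ℝ} {ν : Fin V}
    (hS : 0 < ∑ j, |ct j ν|) : margin ct δ ≤ ENNReal.ofReal (δ ν / ∑ j, |ct j ν|) := by
  rw [ENNReal.ofReal_div_of_pos hS]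
  exact iInf_le _ ν

/-- The smallest eigenvalue of the scaled Gram matrix controls coefficient vectors by the norm of
the combination of scaled feature vectors they define. -/
theorem scaledGramMin_mul_sum_sq_le {p n : ℕ} (x : Fin n → EuclideanSpace ℝ (Fin p)) (Xb B : ℝ)
    (w : Fin p → ℝ) :
    scaledGramMin x Xb B * ∑ j, w j ^ 2
      ≤ ‖∑ j, w j • featureScale x Xb B j • featureVector x j‖ ^ 2 := by
  set M := scaledFeatureMatrix x Xb B with hM
  have h := mul_dotProduct_le_of_le_spectrum (A := M * Mᵀ)
    (by simpa using Matrix.isHermitian_mul_conjTranspose_self M)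
    (fun μ hμ => csInf_le (Matrix.finite_spectrum (M * Mᵀ)).bddBelow hμ) w
  have h1 : w ⬝ᵥ w = ∑ j, w j ^ 2 := by simp [dotProduct, sq]
  have h2 : w ⬝ᵥ ((M * Mᵀ) *ᵥ w)
      = ‖∑ j, w j • featureScale x Xb B j • featureVector x j‖ ^ 2 := by
    rw [← Matrix.mulVec_mulVec, Matrix.dotProduct_mulVec, Matrix.mulVec_transpose,
      EuclideanSpace.real_norm_sq_eq]
    simp [dotProduct, Matrix.vecMul, sq, hM, scaledFeatureMatrix, featureMatrix, featureVector]
  rwa [h1, h2] at h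

theorem featureVector_ne_zero_of_scaledGramMin_pos {p n : ℕ}
    {x : Fin n → EuclideanSpace ℝ (Fin p)} {Xb B : ℝ} (h : 0 < scaledGramMin x Xb B)
    (j : Fin p) : featureVector x j ≠ 0 := by
  classical
  intro hj
  have := scaledGramMin_mul_sum_sq_le x Xb B (Pi.single j 1)
  rw [Finset.sum_eq_single j (fun i _ hi => by simp [hi]) (by simp),
    Finset.sum_eq_single j (fun i _ hi => by simp [hi]) (by simp)] at this
  simp [hj] at this
  linarith

theorem le_constrainedK {p n V : ℕ} {x : Fin n → EuclideanSpace ℝ (Fin p)} {Xb B ε : ℝ}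
    {c : Fin p → Fin V → ℝ} {δ : Fin V → ℝ} (h : 0 < scaledGramMin x Xb B) :
    n * Xb ^ 2 * B ^ 2 / (scaledGramMin x Xb B * (margin (scaledCoeff x Xb B c) δ).toReal ^ 2)
      ≤ constrainedK x Xb B ε c δ := by
  -- `toReal` commutes with the operations, so an infinite margin gives `0` on both sides.
  refine le_trans (le_of_eq ?_)
    ((Nat.le_ceil _).trans (Nat.cast_le.2 (le_max_right (K₀ Xb B ε) _)))
  rw [ENNReal.toReal_div, ENNReal.toReal_mul, ENNReal.toReal_pow, ENNReal.toReal_ofReal h.le,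
    ENNReal.toReal_ofReal (by positivity)]

/-- With `t` the scaled coordinates of `β`, the approximation error bounds every `|k j / K - t j|`
by the margin. The linear constraints hold for `t` with slack `δ ν`, and the margin is chosen so
that the perturbation uses up at most this slack. -/
theorem mem_constrainedIntPolytope {p n V : ℕ} {Xb B ε : ℝ} (hXb : 0 < Xb) (hB : 0 < B)
    {x : Fin n → EuclideanSpace ℝ (Fin p)} {c : Fin p → Fin V → ℝ} {δ : Fin V → ℝ}
    (hδ : ∀ ν, 0 < δ ν) (hmin : 0 < scaledGramMin x Xb B)
    {β : EuclideanSpace ℝ (Fin p)} (hβc : ∀ ν, ∑ j, c j ν * β j + δ ν ≤ 1)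
    {K : ℕ} (hK : K = constrainedK x Xb B ε c δ) (hK0 : 0 < K) {k : Fin p → ℤ}
    (hk : k ∈ intPolytope p K)
    (happrox : ‖(K : ℝ) • ∑ j, β j • featureVector x j
        - ∑ j, (k j : ℝ) • featureScale x Xb B j • featureVector x j‖ ^ 2
        ≤ K * (√(n : ℝ) * Xb * B) ^ 2) :
    k ∈ constrainedIntPolytope (scaledCoeff x Xb B c) K := by
  refine ⟨hk, fun ν => ?_⟩
  set ct := scaledCoeff x Xb B c with hct
  set S := ∑ j, |ct j ν| with hS
  have hK' : (0 : ℝ) < K := Nat.cast_pos.2 hK0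
  rcases (Finset.sum_nonneg fun j _ => abs_nonneg (ct j ν) : 0 ≤ S).eq_or_lt with h0 | hSpos
  · have hz : ∀ j, ct j ν = 0 := fun j => abs_eq_zero.1
      ((Finset.sum_eq_zero_iff_of_nonneg fun j _ => abs_nonneg (ct j ν)).1 h0.symm j
        (Finset.mem_univ j))
    simp [hz]
  -- The constraint `ν` is nontrivial, so the margin is finite and `toReal` loses nothing.
  set m := (margin ct δ).toReal with hm
  have hmle := margin_le ct (δ := δ) hSpos
  have hm0 : 0 < m :=
    ENNReal.toReal_pos (margin_pos ct hδ).ne' (hmle.trans_lt ENNReal.ofReal_lt_top).ne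
  have hmS : m * S ≤ δ ν := by
    rw [← le_div_iff₀ hSpos]
    exact ENNReal.toReal_le_of_le_ofReal (div_nonneg (hδ ν).le hSpos.le) hmle
  have hKm : n * Xb ^ 2 * B ^ 2 ≤ K * (scaledGramMin x Xb B * m ^ 2) := by
    rw [← div_le_iff₀ (by positivity), hK]
    exact le_constrainedK hmin
  set t := scaledCoord x Xb B β with ht
  have hw : ∀ j, |k j - K * t j| ≤ K * m := by
    intro j
    have h1 := scaledGramMin_mul_sum_sq_le x Xb B fun j => K * t j - k j
    have h2 : ∑ j, (K * t j - k j) • featureScale x Xb B j • featureVector x j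
        = (K : ℝ) • ∑ j, β j • featureVector x j
          - ∑ j, (k j : ℝ) • featureScale x Xb B j • featureVector x j := by
      simp only [sub_smul, Finset.sum_sub_distrib, mul_smul, Finset.smul_sum, ht,
        scaledCoord_smul_featureScale_smul hXb hB]
    rw [h2] at h1
    have h3 : (K * t j - k j) ^ 2 ≤ ∑ j, (K * t j - k j) ^ 2 :=
      Finset.single_le_sum (f := fun j => (K * t j - k j) ^ 2) (fun _ _ => sq_nonneg _)
        (Finset.mem_univ j)
    have h4 : scaledGramMin x Xb B * (K * t j - k j) ^ 2
        ≤ scaledGramMin x Xb B * (K * m) ^ 2 := by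
      refine (mul_le_mul_of_nonneg_left h3 hmin.le).trans (h1.trans (happrox.trans ?_))
      rw [mul_pow, mul_pow, Real.sq_sqrt (Nat.cast_nonneg n)]
      nlinarith [mul_le_mul_of_nonneg_left hKm hK'.le]
    rw [abs_sub_comm]
    exact abs_le_of_sq_le_sq (le_of_mul_le_mul_left h4 hmin) (by positivity)
  have hctt : ∑ j, ct j ν * t j = ∑ j, c j ν * β j := by
    refine Finset.sum_congr rfl fun j _ => ?_
    rw [hct, scaledCoeff, mul_assoc, mul_comm (featureScale x Xb B j),
      scaledCoord_mul_featureScale hXb hB β (featureVector_ne_zero_of_scaledGramMin_pos hmin j)]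
  calc ∑ j, ct j ν * (k j : ℝ)
      = K * ∑ j, ct j ν * t j + ∑ j, ct j ν * (k j - K * t j) := by
        rw [Finset.mul_sum, ← Finset.sum_add_distrib]
        exact Finset.sum_congr rfl fun j _ => by ring
    _ ≤ K * ∑ j, ct j ν * t j + ∑ j, |ct j ν| * (K * m) := by
        refine add_le_add_right (Finset.sum_le_sum fun j _ => (le_abs_self _).trans ?_) _
        rw [abs_mul]
        exact mul_le_mul_of_nonneg_left (hw j) (abs_nonneg _)
    _ = K * (∑ j, c j ν * β j + m * S) := by
        rw [hctt, ← Finset.sum_mul]; ring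
    _ ≤ K * 1 := by
        gcongr
        linarith [hβc ν]
    _ = K := mul_one _

/-! ### Covering number bounds -/

theorem corollary1 {p n V : ℕ} (Xb ε : ℝ) (hXb : 0 < Xb) (hε : 0 < ε)
    (x : Fin n → EuclideanSpace ℝ (Fin p)) (hx : ∀ i, ‖x i‖ ≤ Xb)
    (A₁ A₂ : Matrix (Fin p) (Fin p) ℝ)
    (c : Fin p → Fin V → ℝ) (δ : Fin V → ℝ) (hδ : ∀ ν, 0 < δ ν)
    (Aint : Matrix (Fin p) (Fin p) ℝ) (hAint : Aint.PosDef)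
    (hcirc : ellipsoid A₁ ∩ ellipsoid A₂ ⊆ ellipsoid Aint)
    (B : ℝ) (hB : B = √(lambdaMax Aint⁻¹)) :
    (ε < Xb * B →
      coveringNumber (√(n : ℝ) * ε) (restrictTo (functionClass A₁ A₂ c δ) x) ≤
        (intPolytope p (K₀ Xb B ε)).encard ∧
      (0 < scaledGramMin x Xb B →
        coveringNumber (√(n : ℝ) * ε) (restrictTo (functionClass A₁ A₂ c δ) x) ≤
          min (intPolytope p (K₀ Xb B ε)).encard
            (constrainedIntPolytope (scaledCoeff x Xb B c)
              (constrainedK x Xb B ε c δ)).encard)) ∧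
    (Xb * B ≤ ε →
      coveringNumber (√(n : ℝ) * ε) (restrictTo (functionClass A₁ A₂ c δ) x) ≤ 1) := by
  have hnorm : ∀ β ∈ ellipsoid A₁ ∩ ellipsoid A₂, ‖β‖ ≤ B := fun β hβ => by
    rw [hB]
    exact Real.le_sqrt_of_sq_le (norm_sq_le_lambdaMax_inv hAint (hcirc hβ))
  have hr : 0 ≤ √(n : ℝ) * ε := by positivity
  refine ⟨fun hεB => ?_, fun hεB => ?_⟩
  · have hB0 : 0 < B := pos_of_mul_pos_right (hε.trans hεB) hXb.le
    have hK₀ : 0 < K₀ Xb B ε := Nat.ceil_pos.2 (by positivity)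
    have hfree : coveringNumber (√(n : ℝ) * ε) (restrictTo (functionClass A₁ A₂ c δ) x) ≤
        (intPolytope p (K₀ Xb B ε)).encard := by
      refine coveringNumber_le_encard hr _ (fun k => (K₀ Xb B ε : ℝ)⁻¹ •
        ∑ j, (k j : ℝ) • featureScale x Xb B j • featureVector x j) fun v hv => ?_
      obtain ⟨β, hβ, -, rfl⟩ := exists_of_mem_restrictTo_functionClass hv
      obtain ⟨k, hk, h⟩ := exists_intPolytope_approx hXb hB0 hx (hnorm β hβ) (K₀ Xb B ε)
      exact ⟨k, hk, norm_sub_inv_smul_le hε hK₀ le_rfl h⟩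
    refine ⟨hfree, fun hmin => le_min hfree ?_⟩
    have hle : K₀ Xb B ε ≤ constrainedK x Xb B ε c δ := le_max_left _ _
    have hK := hK₀.trans_le hle
    refine coveringNumber_le_encard hr _ (fun k => (constrainedK x Xb B ε c δ : ℝ)⁻¹ •
      ∑ j, (k j : ℝ) • featureScale x Xb B j • featureVector x j) fun v hv => ?_
    obtain ⟨β, hβ, hβc, rfl⟩ := exists_of_mem_restrictTo_functionClass hv
    obtain ⟨k, hk, h⟩ := exists_intPolytope_approx hXb hB0 hx (hnorm β hβ)
      (constrainedK x Xb B ε c δ)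
    exact ⟨k, mem_constrainedIntPolytope hXb hB0 hδ hmin hβc rfl hK hk h,
      norm_sub_inv_smul_le hε hK hle h⟩
  · refine (coveringNumber_le_encard hr {()} (fun _ => 0) fun v hv => ?_).trans_eq
      (Set.encard_singleton ())
    obtain ⟨β, hβ, -, rfl⟩ := exists_of_mem_restrictTo_functionClass hv
    refine ⟨(), rfl, ?_⟩
    rw [sub_zero]
    calc ‖∑ j, β j • featureVector x j‖ ≤ ∑ j, |β j| * ‖featureVector x j‖ :=
          norm_sum_le_of_le _ fun j _ => by rw [norm_smul, Real.norm_eq_abs]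
      _ ≤ √n * Xb * B := sum_abs_mul_norm_featureVector_le hXb.le hx (hnorm β hβ)
      _ ≤ √n * ε := by
          rw [mul_assoc]
          gcongr
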